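/- Let $P, Q \in \mathbf{C}[x,y]$ be two nonzero coprime polynomials (that is, with no nonconstant common factor in $\mathbf{C}[x,y]$), and let $A \in \mathbf{C}[[x]]$ be a formal power series that is non-analytic (that is, it does not converge absolutely in any neighbourhood of the origin) and satisfies the differential equation $$A' = \frac{P(x,A)}{Q(x,A)}$$ in the field $\mathbf{C}((x))$ of formal Laurent series. A power series $A$ is called D-finite if there are an integer $s \ge 0$ and polynomials $b_0, \dots, b_s \in \mathbf{C}[x]$ with $b_s \ne 0$ such that $b_0 A + b_1 A' + \cdots + b_s A^{(s)} = 0$. If $\deg_y Q = 0$ and $\deg_y P \le 1$, then $A$ is D-finite. In all remaining cases, that is, if $\deg_y Q \ge 1$ or $\deg_y P \ge 2$, $A$ is not D-finite. -/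

import Mathlib

open Polynomial PowerSeries

namespace NonPrec

/-- A formal power series over `ℂ` is analytic if it converges absolutely in some neighbourhood of
the origin, i.e. `∑ ‖aₙ‖ rⁿ < ∞` for some `r > 0`. -/
def IsAnalytic (A : ℂ⟦X⟧) : Prop :=
  ∃ r : ℝ, 0 < r ∧ Summable fun n : ℕ => ‖PowerSeries.coeff n A‖ * r ^ n

/-- A formal power series `A` over `ℂ` is D-finite if it satisfies a nontrivial linear differential
equation `b₀ A + b₁ A' + ⋯ + bₛ A⁽ˢ⁾ = 0` with polynomial coefficients, `bₛ ≠ 0`. -/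
def IsDFinite (A : ℂ⟦X⟧) : Prop :=
  ∃ (s : ℕ) (b : ℕ → ℂ[X]), b s ≠ 0 ∧
    ∑ i ∈ Finset.range (s + 1), (b i : ℂ⟦X⟧) * (d⁄dX ℂ)^[i] A = 0

/-- The substitution `P(x, A)` of a power series `A ∈ ℂ⟦x⟧` for `y` in a polynomial
`P ∈ ℂ[x, y]`. A bivariate polynomial is an element of `ℂ[X][X]`: the inner variable is `x`, the
outer variable is `y`, so that `natDegree` is the degree in `y`. -/
noncomputable def evalAt (P : ℂ[X][X]) (A : ℂ⟦X⟧) : ℂ⟦X⟧ :=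
  P.eval₂ (Polynomial.coeToPowerSeries.ringHom : ℂ[X] →+* ℂ⟦X⟧) A

end NonPrec

namespace NonPrec

/-! A power series algebraic over `ℂ(x)` is analytic, so a non-analytic `A` is transcendental, and
an identity between values at `y = A` is an identity in `ℂ[x, y]` (`isAnalytic_of_evalHom_eq_zero`).
The equation then writes every `A⁽ʲ⁾` as a rational function of `x` and `A`, and D-finiteness
becomes linear dependence of these functions over `ℂ[x]`.

If `deg_y Q ≥ 1`, a prime `p` of positive `y`-degree divides `Q`, and each differentiation strictly
raises the order of the pole along `p` (`not_dvd_derivNumerator`). If `Q` depends on `x` only and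
`deg_y P ≥ 2`, each differentiation strictly raises the `y`-degree (`natDegree_derivNumerator_lt`).
Either way the highest derivative cannot be cancelled by the lower ones
(`C_mul_mem_of_linear_relation`). The remaining equation is linear, and eliminating its
inhomogeneous term gives D-finiteness. -/

/-- Substitution of `A` for `y`, as a ring homomorphism. -/
noncomputable def evalHom (A : ℂ⟦X⟧) : ℂ[X][X] →+* ℂ⟦X⟧ :=
  Polynomial.eval₂RingHom Polynomial.coeToPowerSeries.ringHom A

theorem evalHom_apply (A : ℂ⟦X⟧) (F : ℂ[X][X]) : evalHom A F = evalAt F A := rfl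

@[simp]
theorem evalHom_C (A : ℂ⟦X⟧) (p : ℂ[X]) : evalHom A (Polynomial.C p) = (p : ℂ⟦X⟧) := by
  simp [evalHom]

@[simp]
theorem evalHom_X (A : ℂ⟦X⟧) : evalHom A Polynomial.X = A := by
  simp [evalHom]

/-! ### Weighted norms of truncations -/

/-- The sum `∑_{n < N} ‖aₙ‖ rⁿ` of the first `N` terms of the majorant of a power series. -/
noncomputable def partialNorm (r : ℝ) (N : ℕ) (A : ℂ⟦X⟧) : ℝ :=
  ∑ n ∈ Finset.range N, ‖PowerSeries.coeff n A‖ * r ^ n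

theorem partialNorm_nonneg {r : ℝ} (hr : 0 ≤ r) (N : ℕ) (A : ℂ⟦X⟧) : 0 ≤ partialNorm r N A :=
  Finset.sum_nonneg fun _ _ => by positivity

theorem partialNorm_add_le {r : ℝ} (hr : 0 ≤ r) (N : ℕ) (A B : ℂ⟦X⟧) :
    partialNorm r N (A + B) ≤ partialNorm r N A + partialNorm r N B := by
  rw [partialNorm, partialNorm, partialNorm, ← Finset.sum_add_distrib]
  refine Finset.sum_le_sum fun n _ => ?_
  rw [map_add, ← add_mul]
  exact mul_le_mul_of_nonneg_right (norm_add_le _ _) (by positivity)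

theorem partialNorm_mul_le {r : ℝ} (hr : 0 ≤ r) (N : ℕ) (A B : ℂ⟦X⟧) :
    partialNorm r N (A * B) ≤ partialNorm r N A * partialNorm r N B := by
  have key : ∀ n, ‖PowerSeries.coeff n (A * B)‖ * r ^ n ≤
      ∑ p ∈ Finset.HasAntidiagonal.antidiagonal n,
        (‖PowerSeries.coeff p.1 A‖ * r ^ p.1) * (‖PowerSeries.coeff p.2 B‖ * r ^ p.2) := by
    intro n
    rw [PowerSeries.coeff_mul]
    calc _ ≤ (∑ p ∈ Finset.HasAntidiagonal.antidiagonal n,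
          ‖PowerSeries.coeff p.1 A * PowerSeries.coeff p.2 B‖) * r ^ n :=
          mul_le_mul_of_nonneg_right (norm_sum_le _ _) (by positivity)
      _ = _ := by
        rw [Finset.sum_mul]
        refine Finset.sum_congr rfl fun p hp => ?_
        rw [← Finset.HasAntidiagonal.mem_antidiagonal.1 hp, norm_mul, pow_add]
        ring
  have fiber : ∀ n ∈ Finset.range N, Finset.HasAntidiagonal.antidiagonal n =
      {p ∈ Finset.range N ×ˢ Finset.range N | p.1 + p.2 = n} := by
    intro n hn
    ext p
    simp only [Finset.HasAntidiagonal.mem_antidiagonal, Finset.mem_filter, Finset.mem_product,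
      Finset.mem_range] at hn ⊢
    omega
  refine (Finset.sum_le_sum fun n hn => (key n).trans_eq (by rw [fiber n hn])).trans ?_
  rw [partialNorm, partialNorm, Finset.sum_mul_sum, ← Finset.sum_product']
  exact Finset.sum_fiberwise_le_sum_of_sum_fiber_nonneg fun n _ =>
    Finset.sum_nonneg fun p _ => by positivity

theorem partialNorm_X_mul (r : ℝ) (N : ℕ) (A : ℂ⟦X⟧) :
    partialNorm r (N + 1) (PowerSeries.X * A) = r * partialNorm r N A := by
  rw [partialNorm, partialNorm, Finset.sum_range_succ', Finset.mul_sum]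
  simp only [PowerSeries.coeff_succ_X_mul, PowerSeries.coeff_zero_X_mul, norm_zero, zero_mul,
    add_zero]
  exact Finset.sum_congr rfl fun n _ => by ring

theorem partialNorm_C_le (r : ℝ) (N : ℕ) (c : ℂ) :
    partialNorm r N (PowerSeries.C c) ≤ ‖c‖ := by
  rcases N with _ | N
  · simp [partialNorm]
  · rw [partialNorm, Finset.sum_range_succ']
    simp [PowerSeries.coeff_C]

theorem isAnalytic_of_partialNorm_le {r M : ℝ} (hr : 0 < r) {A : ℂ⟦X⟧}
    (h : ∀ N, partialNorm r N A ≤ M) : IsAnalytic A :=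
  ⟨r, hr, summable_of_sum_range_le (fun _ => by positivity) h⟩

theorem exists_partialNorm_polynomial_le (p : ℂ[X]) :
    ∃ M, ∀ r : ℝ, 0 ≤ r → r ≤ 1 → ∀ N, partialNorm r N (p : ℂ⟦X⟧) ≤ M := by
  induction p using Polynomial.induction_on' with
  | add p q hp hq =>
    obtain ⟨M, hM⟩ := hp
    obtain ⟨M', hM'⟩ := hq
    refine ⟨M + M', fun r h0 h1 N => ?_⟩
    rw [Polynomial.coe_add]
    exact (partialNorm_add_le h0 N _ _).trans (add_le_add (hM r h0 h1 N) (hM' r h0 h1 N))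
  | monomial n a =>
    refine ⟨‖a‖, fun r h0 h1 N => ?_⟩
    rw [Polynomial.coe_monomial, partialNorm]
    calc _ ≤ ∑ k ∈ Finset.range N, if k = n then ‖a‖ else 0 := by
          refine Finset.sum_le_sum fun k _ => ?_
          rw [PowerSeries.coeff_monomial]
          split_ifs
          · exact mul_le_of_le_one_right (norm_nonneg _) (pow_le_one₀ h0 h1)
          · simp
      _ ≤ _ := by
        rw [Finset.sum_ite_eq']
        split_ifs <;> simp

/-- The bound is uniform in `r ≤ 1`, so the radius may be chosen after `M`. -/
theorem exists_partialNorm_evalHom_le (K : ℂ[X][X]) (S : ℝ) :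
    ∃ M, ∀ r : ℝ, 0 ≤ r → r ≤ 1 → ∀ N C, partialNorm r N C ≤ S →
      partialNorm r N (evalHom C K) ≤ M := by
  induction K using Polynomial.induction_on with
  | C p =>
    obtain ⟨M, hM⟩ := exists_partialNorm_polynomial_le p
    exact ⟨M, fun r h0 h1 N C _ => by simpa using hM r h0 h1 N⟩
  | add p q hp hq =>
    obtain ⟨M, hM⟩ := hp
    obtain ⟨M', hM'⟩ := hq
    refine ⟨M + M', fun r h0 h1 N C hC => ?_⟩
    rw [map_add]
    exact (partialNorm_add_le h0 N _ _).trans (add_le_add (hM r h0 h1 N C hC) (hM' r h0 h1 N C hC))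
  | monomial n p h =>
    obtain ⟨M, hM⟩ := h
    refine ⟨M * S, fun r h0 h1 N C hC => ?_⟩
    rw [pow_succ, ← mul_assoc, map_mul, evalHom_X]
    have h2 := hM r h0 h1 N C hC
    exact (partialNorm_mul_le h0 N _ _).trans (mul_le_mul h2 hC (partialNorm_nonneg h0 _ _)
      ((partialNorm_nonneg h0 _ _).trans h2))

/-- A power series solution of a fixed point equation `A = c + x K(x, A)` is analytic. -/
theorem isAnalytic_of_eq_C_add_X_mul {A : ℂ⟦X⟧} (c : ℂ) (K : ℂ[X][X])
    (h : A = PowerSeries.C c + PowerSeries.X * evalHom A K) : IsAnalytic A := by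
  obtain ⟨M, hM⟩ := exists_partialNorm_evalHom_le K (‖c‖ + 1)
  -- With `r = 1 / (|M| + 1)` we have `r * M ≤ 1`; since multiplication by `x` shifts the truncation
  -- by one, the bound `‖c‖ + 1` passes from `N` to `N + 1`.
  have hpos : 0 < |M| + 1 := by positivity
  have hr0 : 0 < (|M| + 1)⁻¹ := by positivity
  have hr1 : (|M| + 1)⁻¹ ≤ 1 := inv_le_one_of_one_le₀ (by linarith [abs_nonneg M])
  refine isAnalytic_of_partialNorm_le (M := ‖c‖ + 1) hr0 fun N => ?_
  induction N with
  | zero => simpa [partialNorm] using by positivity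
  | succ N ih =>
    rw [h]
    refine (partialNorm_add_le hr0.le _ _ _).trans (add_le_add (partialNorm_C_le _ _ _) ?_)
    rw [partialNorm_X_mul, inv_mul_le_iff₀ hpos]
    linarith [hM _ hr0.le hr1 N A ih, le_abs_self M]

/-! ### Algebraic power series are analytic -/

theorem IsAnalytic.polynomial_add_X_pow_mul {B : ℂ⟦X⟧} (hB : IsAnalytic B) (T : ℂ[X]) (m : ℕ) :
    IsAnalytic ((T : ℂ⟦X⟧) + PowerSeries.X ^ m * B) := by
  obtain ⟨r, hr, hs⟩ := hB
  refine ⟨r, hr, ?_⟩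
  rw [← summable_nat_add_iff (max m (T.natDegree + 1))]
  have h2 := (summable_nat_add_iff (max m (T.natDegree + 1) - m)).2 hs
  refine (h2.mul_left (r ^ m)).congr fun n => ?_
  have h3 : T.coeff (n + max m (T.natDegree + 1)) = 0 :=
    Polynomial.coeff_eq_zero_of_natDegree_lt (by omega)
  rw [map_add, Polynomial.coeff_coe, h3, zero_add, PowerSeries.coeff_X_pow_mul', if_pos (by lia),
    Nat.add_sub_assoc (le_max_left _ _),
    mul_left_comm, ← pow_add]
  congr 2
  lia

theorem X_pow_dvd_of_coe {p : ℂ[X]} {m : ℕ} (h : PowerSeries.X ^ m ∣ (p : ℂ⟦X⟧)) :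
    Polynomial.X ^ m ∣ p := by
  rw [Polynomial.X_pow_dvd_iff]
  intro d hd
  simpa using PowerSeries.X_pow_dvd_iff.1 h d hd

/-- Hensel-style reduction to a fixed point equation. Let `k` be the order of `F_y(x, A)` and `A = T
+ x^(k+1) B` with `T` a truncation. Expanding `F` at `T` and dividing by `x^(2k+1)` gives `g + u B +
x H B² = 0` with `u(0) ≠ 0`, which can be solved for the constant-coefficient multiple of `B`. -/
theorem isAnalytic_of_simple_root {F : ℂ[X][X]} {A : ℂ⟦X⟧} (h0 : evalHom A F = 0)
    (h1 : evalHom A (Polynomial.derivative F) ≠ 0) : IsAnalytic A := by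
  obtain ⟨k, d, hd, hk⟩ : ∃ (k : ℕ) (d : ℂ⟦X⟧), ¬ PowerSeries.X ∣ d ∧
      evalHom A (Polynomial.derivative F) = PowerSeries.X ^ k * d := by
    obtain ⟨d, h, h'⟩ := (FiniteMultiplicity.of_prime_left PowerSeries.X_prime
      h1).exists_eq_pow_mul_and_not_dvd
    exact ⟨_, d, h', h⟩
  set T := PowerSeries.trunc (k + 1) A
  set B : ℂ⟦X⟧ := PowerSeries.mk fun i => PowerSeries.coeff (i + (k + 1)) A
  have hA : A = (T : ℂ⟦X⟧) + PowerSeries.X ^ (k + 1) * B := by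
    rw [add_comm]
    exact PowerSeries.eq_X_pow_mul_shift_add_trunc (k + 1) A
  have hcoe : ∀ G : ℂ[X][X], ((G.eval T : ℂ[X]) : ℂ⟦X⟧) = evalHom (T : ℂ⟦X⟧) G := by
    intro G
    have := Polynomial.eval₂_at_apply (p := G) Polynomial.coeToPowerSeries.ringHom T
    exact this.symm
  -- `F_y(x, T) = x^k u` with `u(0) ≠ 0`
  obtain ⟨u, hu, hu0⟩ : ∃ u : ℂ[X], (Polynomial.derivative F).eval T = Polynomial.X ^ k * u ∧
      u.coeff 0 ≠ 0 := by
    have hdiff : PowerSeries.X ^ (k + 1) ∣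
        evalHom A (Polynomial.derivative F) - evalHom (T : ℂ⟦X⟧) (Polynomial.derivative F) := by
      refine dvd_trans ⟨B, ?_⟩ (?_ : A - (T : ℂ⟦X⟧) ∣ _)
      · linear_combination hA
      · have h := Polynomial.sub_dvd_eval_sub A (T : ℂ⟦X⟧)
          ((Polynomial.derivative F).map Polynomial.coeToPowerSeries.ringHom)
        rwa [Polynomial.eval_map, Polynomial.eval_map] at h
    obtain ⟨e, he⟩ := hdiff
    have h2 : (((Polynomial.derivative F).eval T : ℂ[X]) : ℂ⟦X⟧) =
        PowerSeries.X ^ k * (d - PowerSeries.X * e) := by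
      rw [hcoe]
      linear_combination hk - he
    obtain ⟨u, hu⟩ := X_pow_dvd_of_coe ⟨_, h2⟩
    refine ⟨u, hu, fun h => hd ?_⟩
    have h3 : (u : ℂ⟦X⟧) = d - PowerSeries.X * e := by
      refine mul_left_cancel₀ (pow_ne_zero k (PowerSeries.X_ne_zero (R := ℂ))) ?_
      rw [← h2, hu]
      simp
    rw [PowerSeries.X_dvd_iff]
    have h4 := congrArg PowerSeries.constantCoeff h3
    simpa [h, ← Polynomial.coeff_zero_eq_eval_zero] using h4.symm
  -- Taylor expansion at `T`
  obtain ⟨H, hH⟩ := (F.map (Polynomial.C : ℂ[X] →+* ℂ[X][X])).binomExpansion (Polynomial.C T)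
    (Polynomial.C (Polynomial.X ^ (k + 1)) * Polynomial.X)
  have hT : 0 = evalHom (T : ℂ⟦X⟧) F + PowerSeries.X ^ (2 * k + 1) * ((u : ℂ⟦X⟧) * B +
      PowerSeries.X * (evalHom B H * B ^ 2)) := by
    have h := congrArg (evalHom B) hH
    have hsub : evalHom B ((F.map (Polynomial.C : ℂ[X] →+* ℂ[X][X])).eval (Polynomial.C T +
        Polynomial.C (Polynomial.X ^ (k + 1)) * Polynomial.X)) = evalHom A F := by
      rw [Polynomial.eval_map, Polynomial.hom_eval₂]
      have : (evalHom B).comp (Polynomial.C : ℂ[X] →+* ℂ[X][X]) =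
          Polynomial.coeToPowerSeries.ringHom := RingHom.ext fun p => evalHom_C B p
      rw [this, map_add, map_mul, evalHom_C, evalHom_C, evalHom_X, Polynomial.coe_pow,
        Polynomial.coe_X, ← hA]
      rfl
    rw [hsub, h0, Polynomial.derivative_map, Polynomial.eval_map, Polynomial.eval_map,
      Polynomial.eval₂_at_apply, Polynomial.eval₂_at_apply, hu] at h
    simp only [map_add, map_mul, map_pow, evalHom_C, evalHom_X, hcoe, Polynomial.coe_X] at h
    rw [h]
    ring
  obtain ⟨g, hg⟩ : Polynomial.X ^ (2 * k + 1) ∣ F.eval T := by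
    refine X_pow_dvd_of_coe ⟨-((u : ℂ⟦X⟧) * B + PowerSeries.X * (evalHom B H * B ^ 2)), ?_⟩
    rw [hcoe]
    linear_combination -hT
  have hB : (g : ℂ⟦X⟧) + (u : ℂ⟦X⟧) * B + PowerSeries.X * (evalHom B H * B ^ 2) = 0 := by
    refine mul_left_cancel₀ (pow_ne_zero (2 * k + 1) (PowerSeries.X_ne_zero (R := ℂ))) ?_
    rw [← hcoe, hg, Polynomial.coe_mul, Polynomial.coe_pow, Polynomial.coe_X] at hT
    linear_combination -hT
  have hsplit : ∀ p : ℂ[X], (p : ℂ⟦X⟧) =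
      PowerSeries.X * (p.divX : ℂ⟦X⟧) + PowerSeries.C (p.coeff 0) := fun p => by
    conv_lhs => rw [← Polynomial.X_mul_divX_add p]
    simp only [Polynomial.coe_add, Polynomial.coe_mul, Polynomial.coe_X, Polynomial.coe_C]
  rw [hA]
  refine IsAnalytic.polynomial_add_X_pow_mul ?_ T (k + 1)
  have hinv : PowerSeries.C (u.coeff 0)⁻¹ * PowerSeries.C (u.coeff 0) = (1 : ℂ⟦X⟧) := by
    rw [← map_mul, inv_mul_cancel₀ hu0, map_one]
  refine isAnalytic_of_eq_C_add_X_mul (-((u.coeff 0)⁻¹ * g.coeff 0))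
    (-(Polynomial.C (Polynomial.C (u.coeff 0)⁻¹) * (Polynomial.C g.divX +
      Polynomial.C u.divX * Polynomial.X + H * Polynomial.X ^ 2))) ?_
  rw [hsplit g, hsplit u] at hB
  simp only [map_neg, map_mul, map_add, map_pow, evalHom_C, evalHom_X, Polynomial.coe_C]
  linear_combination PowerSeries.C (u.coeff 0)⁻¹ * hB - B * hinv

/-- A power series that is algebraic over `ℂ(x)` is analytic. -/
theorem isAnalytic_of_evalHom_eq_zero {F : ℂ[X][X]} (hF : F ≠ 0) {A : ℂ⟦X⟧}
    (h : evalHom A F = 0) : IsAnalytic A := by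
  induction hn : F.natDegree using Nat.strong_induction_on generalizing F with
  | _ n ih =>
    by_cases hd : evalHom A (Polynomial.derivative F) = 0
    · rcases Nat.eq_zero_or_pos F.natDegree with h0 | hpos
      · rw [Polynomial.eq_C_of_natDegree_eq_zero h0, evalHom_C,
          Polynomial.coe_eq_zero_iff] at h
        rw [Polynomial.eq_C_of_natDegree_eq_zero h0, h, map_zero] at hF
        exact absurd rfl hF
      -- If `A` is a multiple root, `F_y` is a nonzero annihilator of smaller degree.
      · refine ih _ (hn ▸ Polynomial.natDegree_derivative_lt hpos.ne') (fun h1 => ?_) hd rfl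
        exact hpos.ne' (Polynomial.derivative_eq_zero.1 h1)
    · exact isAnalytic_of_simple_root h hd

/-! ### Derivatives of a solution of the differential equation -/

/-- The partial derivative `∂/∂x` on `ℂ[x, y]`. -/
noncomputable def xDeriv : Derivation ℤ ℂ[X][X] ℂ[X][X] :=
  letI : Differential ℂ[X] := ⟨(Polynomial.derivative' (R := ℂ)).restrictScalars ℤ⟩
  Differential.mapCoeffs

theorem coeff_xDeriv (F : ℂ[X][X]) (i : ℕ) :
    (xDeriv F).coeff i = Polynomial.derivative (F.coeff i) := rfl

theorem natDegree_xDeriv_le (F : ℂ[X][X]) : (xDeriv F).natDegree ≤ F.natDegree := by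
  refine Polynomial.natDegree_le_iff_coeff_eq_zero.2 fun i hi => ?_
  rw [coeff_xDeriv, Polynomial.coeff_eq_zero_of_natDegree_lt hi, Polynomial.derivative_zero]

theorem xDeriv_C (p : ℂ[X]) :
    xDeriv (Polynomial.C p) = Polynomial.C (Polynomial.derivative p) := by
  ext1 i
  rw [coeff_xDeriv, Polynomial.coeff_C, Polynomial.coeff_C]
  split_ifs <;> simp

theorem xDeriv_X : xDeriv Polynomial.X = 0 := by
  ext1 i
  rw [coeff_xDeriv, Polynomial.coeff_X]
  split_ifs <;> simp

theorem derivative_evalHom (A : ℂ⟦X⟧) (F : ℂ[X][X]) :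
    d⁄dX ℂ (evalHom A F) =
      evalHom A (xDeriv F) + evalHom A (Polynomial.derivative F) * d⁄dX ℂ A := by
  induction F using Polynomial.induction_on with
  | C p => simp [xDeriv_C, PowerSeries.derivative_coe]
  | add p q hp hq => simp only [map_add, hp, hq]; ring
  | monomial n p h =>
    rw [pow_succ, ← mul_assoc, map_mul, Derivation.leibniz, h,
      Derivation.leibniz xDeriv (Polynomial.C p * Polynomial.X ^ n) Polynomial.X, xDeriv_X,
      Polynomial.derivative_mul (f := Polynomial.C p * Polynomial.X ^ n), Polynomial.derivative_X]
    simp only [smul_eq_mul, map_add, map_mul, evalHom_X, map_zero, map_one]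
    ring

/-- The vector field `Q ∂/∂x + P ∂/∂y` on `ℂ[x, y]`. -/
noncomputable def fieldDeriv (P Q F : ℂ[X][X]) : ℂ[X][X] :=
  Q * xDeriv F + P * Polynomial.derivative F

theorem evalHom_fieldDeriv {P Q : ℂ[X][X]} {A : ℂ⟦X⟧}
    (h : evalHom A Q * d⁄dX ℂ A = evalHom A P) (F : ℂ[X][X]) :
    evalHom A (fieldDeriv P Q F) = evalHom A Q * d⁄dX ℂ (evalHom A F) := by
  rw [derivative_evalHom, fieldDeriv, map_add, map_mul, map_mul]
  linear_combination -evalHom A (Polynomial.derivative F) * h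

theorem mul_derivative_pow (f : ℂ⟦X⟧) (n : ℕ) :
    f * d⁄dX ℂ (f ^ n) = n * f ^ n * d⁄dX ℂ f := by
  rcases n with _ | n
  · simp
  · rw [PowerSeries.derivative_pow, Nat.add_sub_cancel]
    ring

/-- The numerators of the derivatives of a solution of `A' = P / (pᵐ q)`: the derivative of order
`j + 1` has denominator `p ^ (m + j (m + 1)) * q ^ (1 + 2 j)`. -/
noncomputable def derivNumerator (P p q : ℂ[X][X]) (m : ℕ) : ℕ → ℂ[X][X]
  | 0 => P
  | j + 1 => p * q * fieldDeriv P (p ^ m * q) (derivNumerator P p q m j) -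
      derivNumerator P p q m j *
        ((m + j * (m + 1) : ℕ) * q * fieldDeriv P (p ^ m * q) p +
          (1 + 2 * j : ℕ) * p * fieldDeriv P (p ^ m * q) q)

theorem iterate_derivative_mul_eq {P p q : ℂ[X][X]} {m : ℕ} {A : ℂ⟦X⟧}
    (h : evalHom A (p ^ m * q) * d⁄dX ℂ A = evalHom A P) (j : ℕ) :
    (d⁄dX ℂ)^[j + 1] A * evalHom A (p ^ (m + j * (m + 1)) * q ^ (1 + 2 * j)) =
      evalHom A (derivNumerator P p q m j) := by
  induction j with
  | zero =>
    rw [derivNumerator, ← h]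
    simp [mul_comm]
  | succ j ih =>
    have hd := congrArg (d⁄dX ℂ) ih
    simp only [map_mul, map_pow, Derivation.leibniz, smul_eq_mul,
      ← Function.iterate_succ_apply' (d⁄dX ℂ)] at hd ih
    have hp := mul_derivative_pow (evalHom A p) (m + j * (m + 1))
    have hq := mul_derivative_pow (evalHom A q) (1 + 2 * j)
    rw [derivNumerator]
    simp only [map_sub, map_mul, map_add, map_pow, evalHom_fieldDeriv h, map_natCast]
    rw [show m + (j + 1) * (m + 1) = (m + j * (m + 1)) + m + 1 by ring,
      show 1 + 2 * (j + 1) = (1 + 2 * j) + 2 by ring]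
    generalize m + j * (m + 1) = c at *
    generalize 1 + 2 * j = e at *
    rw [← ih]
    rw [← ih] at hd
    generalize evalHom A p = a at *
    generalize evalHom A q = b at *
    linear_combination a ^ (m + 1) * b ^ 2 * hd - (d⁄dX ℂ)^[j + 1] A * a ^ m * b ^ (e + 2) * hp -
      (d⁄dX ℂ)^[j + 1] A * a ^ (m + 1 + c) * b * hq

/-- Modulo `p` the vector field reduces to `P ∂/∂y`, as `p ∣ p ^ m * q`. The recursion becomes
`N_{j+1} ≡ -(m + j(m+1)) q P p_y N_j`, in which `p` divides no factor; the integer is a unit because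
it is nonzero. -/
theorem not_dvd_derivNumerator {P p q : ℂ[X][X]} {m : ℕ} (hp : Prime p) (hm : m ≠ 0)
    (hpP : ¬ p ∣ P) (hpq : ¬ p ∣ q) (hpd : ¬ p ∣ Polynomial.derivative p) (j : ℕ) :
    ¬ p ∣ derivNumerator P p q m j := by
  induction j with
  | zero => exact hpP
  | succ j ih =>
    obtain ⟨r, hr⟩ : p ∣ p ^ m * q := (dvd_pow_self p hm).mul_right q
    have hc : ¬ p ∣ ((m + j * (m + 1) : ℕ) : ℂ[X][X]) := by
      intro h
      refine hp.not_isUnit (isUnit_of_dvd_unit h ?_)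
      rw [← map_natCast (algebraMap ℂ ℂ[X][X])]
      refine IsUnit.map _ (isUnit_iff_ne_zero.2 (Nat.cast_ne_zero.2 (by omega)))
    have key : ¬ p ∣ derivNumerator P p q m j *
        ((m + j * (m + 1) : ℕ) * q * (P * Polynomial.derivative p)) := by
      simp only [hp.dvd_mul, not_or]
      exact ⟨ih, ⟨hc, hpq⟩, hpP, hpd⟩
    intro h
    refine key ?_
    rw [derivNumerator] at h
    simp only [fieldDeriv] at h
    generalize ((m + j * (m + 1) : ℕ) : ℂ[X][X]) = c at *
    obtain ⟨g, hg⟩ := h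
    rw [hr] at hg
    refine ⟨q * fieldDeriv P (p * r) (derivNumerator P p q m j) - derivNumerator P p q m j *
      (c * q * (r * xDeriv p) + (1 + 2 * j : ℕ) * fieldDeriv P (p * r) q) - g, ?_⟩
    simp only [fieldDeriv]
    linear_combination -hg

/-- The term `q P N_y` has degree `deg P + deg N - 1 > deg N`, while all others have degree at most
`deg N`. -/
theorem natDegree_derivNumerator_lt {P : ℂ[X][X]} {q : ℂ[X]} (hq : q ≠ 0) (hP : 2 ≤ P.natDegree)
    (j : ℕ) : 2 ≤ (derivNumerator P 1 (Polynomial.C q) 0 j).natDegree ∧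
      (derivNumerator P 1 (Polynomial.C q) 0 j).natDegree <
        (derivNumerator P 1 (Polynomial.C q) 0 (j + 1)).natDegree := by
  have step : ∀ N : ℂ[X][X], 2 ≤ N.natDegree → ∀ c e : ℕ, N.natDegree <
      (1 * Polynomial.C q * fieldDeriv P (1 ^ 0 * Polynomial.C q) N - N *
        (c * Polynomial.C q * fieldDeriv P (1 ^ 0 * Polynomial.C q) 1 +
          e * 1 * fieldDeriv P (1 ^ 0 * Polynomial.C q) (Polynomial.C q))).natDegree := by
    intro N hN c e
    have e1 : 1 * Polynomial.C q * fieldDeriv P (1 ^ 0 * Polynomial.C q) N - N *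
        (c * Polynomial.C q * fieldDeriv P (1 ^ 0 * Polynomial.C q) 1 +
          e * 1 * fieldDeriv P (1 ^ 0 * Polynomial.C q) (Polynomial.C q)) =
        Polynomial.C q * (P * Polynomial.derivative N) + (Polynomial.C (q ^ 2) * xDeriv N -
          Polynomial.C (e * q * Polynomial.derivative q) * N) := by
      simp only [fieldDeriv, xDeriv_C, Polynomial.derivative_C, Derivation.map_one_eq_zero,
        Polynomial.derivative_one, map_mul, map_pow, map_natCast]
      ring
    have hN' : Polynomial.derivative N ≠ 0 := fun h => by
      have := Polynomial.derivative_eq_zero.1 h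
      omega
    have hP0 : P ≠ 0 := by rintro rfl; simp at hP
    have e2 : (Polynomial.C q * (P * Polynomial.derivative N)).natDegree =
        P.natDegree + (N.natDegree - 1) := by
      rw [Polynomial.natDegree_C_mul hq, Polynomial.natDegree_mul hP0 hN',
        Polynomial.natDegree_derivative]
    have e3 : (Polynomial.C (q ^ 2) * xDeriv N -
        Polynomial.C (e * q * Polynomial.derivative q) * N).natDegree ≤ N.natDegree :=
      (Polynomial.natDegree_sub_le_of_le
        ((Polynomial.natDegree_C_mul_le _ _).trans (natDegree_xDeriv_le N))
        (Polynomial.natDegree_C_mul_le _ _)).trans_eq (max_self _)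
    rw [e1, Polynomial.natDegree_add_eq_left_of_natDegree_lt (by omega)]
    omega
  have h2 : 2 ≤ (derivNumerator P 1 (Polynomial.C q) 0 j).natDegree := by
    induction j with
    | zero => exact hP
    | succ j ih => exact ih.trans (step _ ih _ _).le
  exact ⟨h2, step _ h2 _ _⟩

/-! ### D-finiteness -/

/-- If the lower derivatives of `A`, multiplied by `W(x, A)`, are values of elements of a submodule
`I` of `ℂ[x, y]`, then a differential equation `b₀ A + ⋯ + bₛ A⁽ˢ⁾ = 0` of a transcendental `A`
forces `I` to contain `bₛ N`, where `N(x, A) = A⁽ˢ⁾ W(x, A)`. -/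
theorem C_mul_mem_of_linear_relation {A : ℂ⟦X⟧} (hA : ∀ F, evalHom A F = 0 → F = 0)
    {s : ℕ} {b : ℕ → ℂ[X]}
    (hb : ∑ i ∈ Finset.range (s + 1), (b i : ℂ⟦X⟧) * (d⁄dX ℂ)^[i] A = 0)
    {W N : ℂ[X][X]} (I : Submodule ℂ[X] ℂ[X][X])
    (hN : (d⁄dX ℂ)^[s] A * evalHom A W = evalHom A N)
    (hI : ∀ i < s, ∃ g ∈ I, (d⁄dX ℂ)^[i] A * evalHom A W = evalHom A g) :
    Polynomial.C (b s) * N ∈ I := by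
  choose! g hgI hg using hI
  have h : evalHom A (∑ i ∈ Finset.range s, Polynomial.C (b i) * g i + Polynomial.C (b s) * N) =
      0 := by
    rw [map_add, map_sum, map_mul, ← hN]
    rw [Finset.sum_range_succ] at hb
    have h1 : ∑ i ∈ Finset.range s, evalHom A (Polynomial.C (b i) * g i) =
        (∑ i ∈ Finset.range s, (b i : ℂ⟦X⟧) * (d⁄dX ℂ)^[i] A) * evalHom A W := by
      rw [Finset.sum_mul]
      refine Finset.sum_congr rfl fun i hi => ?_
      rw [map_mul, ← hg i (Finset.mem_range.1 hi), evalHom_C, mul_assoc]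
    rw [h1, evalHom_C]
    linear_combination evalHom A W * hb
  rw [eq_neg_of_add_eq_zero_right (hA _ h)]
  refine I.neg_mem (I.sum_mem fun i hi => ?_)
  rw [← Polynomial.smul_eq_C_mul]
  exact I.smul_mem _ (hgI i (Finset.mem_range.1 hi))

theorem evalHom_C_mul_X_ne_zero {A : ℂ⟦X⟧} (hA : ∀ F, evalHom A F = 0 → F = 0) {b : ℂ[X]}
    (hb : b ≠ 0) : (b : ℂ⟦X⟧) * A ≠ 0 := by
  intro h
  have := hA (Polynomial.C b * Polynomial.X) (by simpa using h)
  simp [hb] at this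

theorem not_isDFinite_of_prime_dvd {P p q : ℂ[X][X]} {m : ℕ} {A : ℂ⟦X⟧}
    (hA : ∀ F, evalHom A F = 0 → F = 0)
    (h : evalHom A (p ^ m * q) * d⁄dX ℂ A = evalHom A P)
    (hp : Prime p) (hp0 : p.natDegree ≠ 0) (hm : m ≠ 0) (hpP : ¬ p ∣ P) (hpq : ¬ p ∣ q) :
    ¬ IsDFinite A := by
  rintro ⟨s, b, hbs, hb⟩
  rcases s with _ | t
  · exact evalHom_C_mul_X_ne_zero hA hbs (by simpa using hb)
  -- In characteristic zero `p_y` is nonzero, and its degree is below that of `p`.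
  have hpd : ¬ p ∣ Polynomial.derivative p := fun hd =>
    (Polynomial.natDegree_derivative_lt hp0).not_ge
      (Polynomial.natDegree_le_of_dvd hd fun h0 => hp0 (Polynomial.derivative_eq_zero.1 h0))
  -- Over the denominator of the highest derivative, all lower ones keep a spare factor `p`. Hence
  -- `p` divides `b s` times the top numerator, but it divides neither factor.
  have hmem := C_mul_mem_of_linear_relation hA hb ((Ideal.span {p}).restrictScalars ℂ[X])
    (iterate_derivative_mul_eq h t) ?_
  · rw [Submodule.restrictScalars_mem, Ideal.mem_span_singleton, hp.dvd_mul] at hmem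
    rcases hmem with hd | hd
    · have := Polynomial.natDegree_le_of_dvd hd (Polynomial.C_ne_zero.2 hbs)
      rw [Polynomial.natDegree_C] at this
      omega
    · exact not_dvd_derivNumerator hp hm hpP hpq hpd t hd
  · intro i hi
    rcases i with _ | k
    · refine ⟨Polynomial.X * (p ^ (m + t * (m + 1)) * q ^ (1 + 2 * t)), ?_, by simp⟩
      rw [Submodule.restrictScalars_mem, Ideal.mem_span_singleton]
      exact ((dvd_pow_self p (by omega)).mul_right _).mul_left _
    · obtain ⟨l, rfl⟩ : ∃ l, t = k + l + 1 := ⟨t - k - 1, by omega⟩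
      refine ⟨derivNumerator P p q m k * (p ^ ((l + 1) * (m + 1)) * q ^ (2 * (l + 1))), ?_, ?_⟩
      · rw [Submodule.restrictScalars_mem, Ideal.mem_span_singleton]
        exact ((dvd_pow_self p (by positivity)).mul_right _).mul_left _
      · have hW : p ^ (m + (k + l + 1) * (m + 1)) * q ^ (1 + 2 * (k + l + 1)) =
            p ^ (m + k * (m + 1)) * q ^ (1 + 2 * k) *
              (p ^ ((l + 1) * (m + 1)) * q ^ (2 * (l + 1))) := by
          ring
        rw [hW, map_mul (evalHom A) (derivNumerator _ _ _ _ _), ← iterate_derivative_mul_eq h k,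
          mul_assoc ((d⁄dX ℂ)^[k + 1] A), ← map_mul]

theorem not_isDFinite_of_two_le_natDegree {P : ℂ[X][X]} {q : ℂ[X]} {A : ℂ⟦X⟧}
    (hA : ∀ F, evalHom A F = 0 → F = 0)
    (h : evalHom A (Polynomial.C q) * d⁄dX ℂ A = evalHom A P)
    (hq : q ≠ 0) (hP : 2 ≤ P.natDegree) : ¬ IsDFinite A := by
  rintro ⟨s, b, hbs, hb⟩
  rcases s with _ | t
  · exact evalHom_C_mul_X_ne_zero hA hbs (by simpa using hb)
  have h' : evalHom A (1 ^ 0 * Polynomial.C q) * d⁄dX ℂ A = evalHom A P := by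
    rwa [pow_zero, one_mul]
  have hdeg := natDegree_derivNumerator_lt hq hP
  have hmono : StrictMono fun j => (derivNumerator P 1 (Polynomial.C q) 0 j).natDegree :=
    strictMono_nat_of_lt_succ fun j => (hdeg j).2
  have hne : derivNumerator P 1 (Polynomial.C q) 0 t ≠ 0 := fun h0 => by
    have := (hdeg t).1
    simp [h0] at this
  -- The denominators are powers of `q ∈ ℂ[x]`, so clearing them leaves `y`-degrees unchanged; the
  -- top numerator would have degree below its own.
  have hmem := C_mul_mem_of_linear_relation hA hb
    (Polynomial.degreeLT ℂ[X] (derivNumerator P 1 (Polynomial.C q) 0 t).natDegree)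
    (iterate_derivative_mul_eq h' t) ?_
  · rw [Polynomial.mem_degreeLT, Polynomial.degree_C_mul hbs,
      Polynomial.degree_eq_natDegree hne] at hmem
    exact lt_irrefl _ hmem
  · intro i hi
    rcases i with _ | k
    · refine ⟨Polynomial.X * (1 ^ (0 + t * (0 + 1)) * Polynomial.C q ^ (1 + 2 * t)), ?_, by simp⟩
      rw [Polynomial.mem_degreeLT, one_pow, one_mul, ← Polynomial.C_pow, mul_comm,
        Polynomial.degree_C_mul (pow_ne_zero _ hq), Polynomial.degree_X]
      exact_mod_cast (hdeg t).1
    · obtain ⟨l, rfl⟩ : ∃ l, t = k + l + 1 := ⟨t - k - 1, by omega⟩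
      refine ⟨derivNumerator P 1 (Polynomial.C q) 0 k * Polynomial.C (q ^ (2 * (l + 1))), ?_, ?_⟩
      · rw [Polynomial.mem_degreeLT, mul_comm, Polynomial.degree_C_mul (pow_ne_zero _ hq)]
        exact Polynomial.degree_le_natDegree.trans_lt (by exact_mod_cast hmono (by omega))
      · have hW : 1 ^ (0 + (k + l + 1) * (0 + 1)) * Polynomial.C q ^ (1 + 2 * (k + l + 1)) =
            1 ^ (0 + k * (0 + 1)) * Polynomial.C q ^ (1 + 2 * k) *
              Polynomial.C (q ^ (2 * (l + 1))) := by
          rw [Polynomial.C_pow]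
          ring
        rw [hW, map_mul (evalHom A) (derivNumerator _ _ _ _ _), ← iterate_derivative_mul_eq h' k,
          mul_assoc ((d⁄dX ℂ)^[k + 1] A), ← map_mul]

/-- If `p₀ ≠ 0`, then `p₀` times the differentiated equation minus `p₀'` times the equation is
homogeneous of order two, with leading coefficient `p₀ q`. -/
theorem isDFinite_of_linear {q p₀ p₁ : ℂ[X]} {A : ℂ⟦X⟧} (hq : q ≠ 0)
    (h : (q : ℂ⟦X⟧) * d⁄dX ℂ A = (p₁ : ℂ⟦X⟧) * A + p₀) : IsDFinite A := by
  by_cases hp : p₀ = 0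
  · refine ⟨1, fun i => if i = 0 then -p₁ else q, by simpa using hq, ?_⟩
    simp [Finset.sum_range_succ, h, hp]
  · refine ⟨2, fun i => if i = 0 then Polynomial.derivative p₀ * p₁ - p₀ * Polynomial.derivative p₁
      else if i = 1 then p₀ * Polynomial.derivative q - p₀ * p₁ - Polynomial.derivative p₀ * q
      else p₀ * q, by simpa using ⟨hp, hq⟩, ?_⟩
    have hd := congrArg (d⁄dX ℂ) h
    simp only [map_add, Derivation.leibniz, smul_eq_mul, PowerSeries.derivative_coe] at hd
    simp [Finset.sum_range_succ, sub_eq_add_neg]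
    linear_combination (p₀ : ℂ⟦X⟧) * hd - (Polynomial.derivative p₀ : ℂ⟦X⟧) * h

theorem exists_prime_dvd_natDegree_ne_zero {Q : ℂ[X][X]} (hQ : Q.natDegree ≠ 0) :
    ∃ p, Prime p ∧ p ∣ Q ∧ p.natDegree ≠ 0 := by
  induction Q using UniqueFactorizationMonoid.induction_on_prime with
  | h₁ => simp at hQ
  | h₂ x hx => exact absurd (Polynomial.natDegree_eq_zero_of_isUnit hx) hQ
  | h₃ a p ha hp ih =>
    by_cases h : p.natDegree = 0
    · rw [Polynomial.natDegree_mul hp.ne_zero ha, h, zero_add] at hQ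
      obtain ⟨r, hr, hra, hr0⟩ := ih hQ
      exact ⟨r, hr, hra.mul_left p, hr0⟩
    · exact ⟨p, hp, dvd_mul_right p a, h⟩

end NonPrec

theorem theorem2p2 (P Q : ℂ[X][X]) (hP : P ≠ 0) (hQ : Q ≠ 0) (hPQ : IsRelPrime P Q)
    (A : ℂ⟦X⟧) (hA : ¬ NonPrec.IsAnalytic A)
    (hode : ((d⁄dX ℂ A : ℂ⟦X⟧) : LaurentSeries ℂ) =
      (NonPrec.evalAt P A : LaurentSeries ℂ) / (NonPrec.evalAt Q A : LaurentSeries ℂ)) :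
    ((Q.natDegree = 0 ∧ P.natDegree ≤ 1) → NonPrec.IsDFinite A) ∧
      (¬ (Q.natDegree = 0 ∧ P.natDegree ≤ 1) → ¬ NonPrec.IsDFinite A) := by
  have htr : ∀ F, NonPrec.evalHom A F = 0 → F = 0 := fun F hF => by
    by_contra h0
    exact hA (NonPrec.isAnalytic_of_evalHom_eq_zero h0 hF)
  have h : NonPrec.evalHom A Q * d⁄dX ℂ A = NonPrec.evalHom A P := by
    rw [← NonPrec.evalHom_apply, ← NonPrec.evalHom_apply, eq_div_iff, ← PowerSeries.coe_mul] at hode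
    · rw [mul_comm]
      exact HahnSeries.ofPowerSeries_injective hode
    -- Transcendence of `A` makes the denominator `Q(x, A)` nonzero, so the division is genuine.
    · exact fun h0 => hQ (htr Q (HahnSeries.ofPowerSeries_injective (Γ := ℤ)
        (h0.trans (map_zero _).symm)))
  constructor
  · rintro ⟨hQ0, hP1⟩
    rw [Polynomial.eq_C_of_natDegree_eq_zero hQ0] at h hQ
    rw [Polynomial.eq_X_add_C_of_natDegree_le_one hP1] at h
    exact NonPrec.isDFinite_of_linear (p₀ := P.coeff 0) (p₁ := P.coeff 1)
      (Polynomial.C_ne_zero.1 hQ) (by simpa using h)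
  · intro hne
    by_cases hQ0 : Q.natDegree = 0
    · rw [Polynomial.eq_C_of_natDegree_eq_zero hQ0] at h hQ
      exact NonPrec.not_isDFinite_of_two_le_natDegree htr h (Polynomial.C_ne_zero.1 hQ) (by omega)
    · obtain ⟨p, hp, hpQ, hp0⟩ := NonPrec.exists_prime_dvd_natDegree_ne_zero hQ0
      obtain ⟨q, hq, hpq⟩ :=
        (FiniteMultiplicity.of_prime_left hp hQ).exists_eq_pow_mul_and_not_dvd
      rw [hq] at h
      refine NonPrec.not_isDFinite_of_prime_dvd htr h hp hp0 (fun hm => ?_)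
        (fun hpP => hp.not_isUnit (hPQ hpP hpQ)) hpq
      rw [hm, pow_zero, one_mul] at hq
      exact hpq (hq ▸ hpQ)
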